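/- For $d\ge 1$, let $\mathbb{Z}_2^d$ be the group of $d$-tuples of integers modulo $2$. A set $E\subseteq\mathbb{Z}_2^d$ is *spectral* if there is a set $B\subseteq\mathbb{Z}_2^d$ such that the exponentials $e_b(x)=e^{2\pi i\,(b\cdot x)/2}=(-1)^{b\cdot x}$, $b\in B$, restricted to $E$, form an orthogonal basis of $L^2(E)$, the space of functions $E\to\mathbb{C}$ with $\langle f,g\rangle=\sum_{x\in E}f(x)\overline{g(x)}$. The set $E$ is a *tile* if there is a set $T\subseteq\mathbb{Z}_2^d$ such that every element of $\mathbb{Z}_2^d$ can be written in exactly one way as $x+t$ with $x\in E$ and $t\in T$. **Proposition.** Let $d=5$ or $d=6$, and let $E\subseteq\mathbb{Z}_2^d$ be a set whose size is a power of $2$ (that is, $|E|=2^k$ for some integer $k\ge 0$). Then $E$ is spectral if and only if $E$ is a tile. -/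

import Mathlib

open scoped ComplexConjugate

/-- The group `ℤ₂^d`. -/
abbrev Z2 (d : ℕ) : Type := Fin d → ZMod 2

/-- The exponential `e_b(x) = exp(2πi (b · x) / 2)` on `ℤ₂^d` with frequency `b`. -/
noncomputable def expo {d : ℕ} (b x : Z2 d) : ℂ := ZMod.stdAddChar (b ⬝ᵥ x)

/-- `B` is a spectrum of `E`: the restrictions to `E` of the exponentials with frequencies in `B`
form an orthogonal basis of `L²(E)`, the space of all complex functions on `E` with
`⟨f, g⟩ = ∑ x ∈ E, f x * conj (g x)`. -/
def IsSpectrum {d : ℕ} (E B : Finset (Z2 d)) : Prop :=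
  (∀ b ∈ B, ∀ b' ∈ B, b ≠ b' → ∑ x ∈ E, expo b x * conj (expo b' x) = 0) ∧
    Submodule.span ℂ ((fun (b : Z2 d) (x : E) => expo b (x : Z2 d)) '' (B : Set (Z2 d))) = ⊤

/-- `E` is spectral: it has a spectrum. -/
def IsSpectral {d : ℕ} (E : Finset (Z2 d)) : Prop :=
  ∃ B : Finset (Z2 d), IsSpectrum E B

/-- `E` is a tile: for some `T`, the translates `E + t`, `t ∈ T`, partition the group, that is,
every element is uniquely `x + t` with `x ∈ E` and `t ∈ T`. -/
def IsTile {d : ℕ} (E : Finset (Z2 d)) : Prop :=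
  ∃ T : Finset (Z2 d), ∀ g : Z2 d, ∃! p : Z2 d × Z2 d, p.1 ∈ E ∧ p.2 ∈ T ∧ p.1 + p.2 = g

/-!
If some linear map to `ℤ₂^k` is injective on a set `E` with `|E| = 2 ^ k`, then `E` tiles with its
kernel, and the image of its transpose is a spectrum of `E`. For `k ≤ 3` or `d ≤ k + 2`, tiles and
spectral sets in `ℤ₂^d` of size `2 ^ k` all arise in this way.

Such a map is found by projecting repeatedly along a nonzero vector outside `E - E`.
If `T` is a tiling complement of `E`, then `T - T` meets `E - E` only in `0`; so does the support of
the Fourier transform of a spectrum of `E`. For `d ≤ k + 2` these sets contain the one or two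
directions required. For `k ≤ 2` a direction exists because `E` has few pairs. For `k = 3` counting
pairs reaches dimension four only. But both sets contain `∑ x ∈ E, x`, so that one may first
project along this vector and assume it is `0`; then in dimension four every nonzero element of
`E - E` is a difference in at least four ways, and the `15` nonzero vectors cannot all share the
`56` ordered pairs.
-/

open Finset
open scoped Pointwise

variable {d k n : ℕ}

/-- Some linear map to `ℤ₂^k` is injective on `E`. For `|E| = 2^k` this says that `E` is a
transversal of a subspace of codimension `k`, that is, a graph over a `k`-dimensional space. -/
def ProjectsInjectively (k : ℕ) (E : Finset (Z2 d)) : Prop :=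
  ∃ L : Z2 d →ₗ[ZMod 2] Z2 k, Set.InjOn L E

theorem zmod_two_eq_zero_or_one (a : ZMod 2) : a = 0 ∨ a = 1 :=
  Fin.exists_fin_two.1 ⟨a, rfl⟩

theorem card_Z2 (d : ℕ) : Fintype.card (Z2 d) = 2 ^ d := by
  simp

theorem le_of_card_eq_two_pow {E : Finset (Z2 d)} (hE : #E = 2 ^ k) : k ≤ d := by
  have h := E.card_le_univ
  rwa [hE, card_Z2, Nat.pow_le_pow_iff_right one_lt_two] at h

section Projections

theorem projectsInjectively_self (E : Finset (Z2 d)) : ProjectsInjectively d E :=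
  ⟨LinearMap.id, Function.injective_id.injOn⟩

theorem ProjectsInjectively.of_image {E : Finset (Z2 d)} {L : Z2 d →ₗ[ZMod 2] Z2 n}
    (hL : Set.InjOn L E) (h : ProjectsInjectively k (E.image L)) : ProjectsInjectively k E := by
  obtain ⟨M, hM⟩ := h
  rw [coe_image] at hM
  exact ⟨M ∘ₗ L, hM.comp hL (Set.mapsTo_image L E)⟩

theorem exists_linearMap_ker_eq_pair {u : Z2 (n + 1)} (hu : u ≠ 0) :
    ∃ L : Z2 (n + 1) →ₗ[ZMod 2] Z2 n, ∀ x, L x = 0 ↔ x = 0 ∨ x = u := by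
  let P := Submodule.span (ZMod 2) {u}
  have hrank : Module.finrank (ZMod 2) (Z2 (n + 1) ⧸ P) = Module.finrank (ZMod 2) (Z2 n) := by
    have hsum := P.finrank_quotient_add_finrank
    rw [finrank_span_singleton hu, Module.finrank_fin_fun] at hsum
    rw [Module.finrank_fin_fun]
    omega
  refine ⟨(LinearEquiv.ofFinrankEq _ _ hrank).toLinearMap ∘ₗ P.mkQ, fun x => ?_⟩
  simp only [LinearMap.comp_apply, LinearEquiv.coe_coe, LinearEquiv.map_eq_zero_iff,
    Submodule.mkQ_apply, Submodule.Quotient.mk_eq_zero, P, Submodule.mem_span_singleton]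
  constructor
  · rintro ⟨a, rfl⟩
    obtain rfl | rfl := zmod_two_eq_zero_or_one a
    exacts [.inl (zero_smul _ u), .inr (one_smul _ u)]
  · rintro (rfl | rfl)
    exacts [⟨0, zero_smul _ u⟩, ⟨1, one_smul _ x⟩]

theorem injOn_of_notMem_sub {E : Finset (Z2 d)} {u : Z2 d} (hu : u ∉ E - E)
    {L : Z2 d →ₗ[ZMod 2] Z2 n} (hL : ∀ x, L x = 0 → x = 0 ∨ x = u) : Set.InjOn L E := by
  intro x hx y hy hxy
  obtain h | h := hL (x - y) (by rw [map_sub, hxy, sub_self])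
  · exact sub_eq_zero.1 h
  · exact absurd (h ▸ sub_mem_sub hx hy) hu

theorem ProjectsInjectively.of_notMem_sub {E : Finset (Z2 (n + 1))} {u : Z2 (n + 1)}
    (hu0 : u ≠ 0) (hu : u ∉ E - E) : ProjectsInjectively n E := by
  obtain ⟨L, hL⟩ := exists_linearMap_ker_eq_pair hu0
  exact ⟨L, injOn_of_notMem_sub hu fun x => (hL x).1⟩

theorem ProjectsInjectively.of_plane_notMem_sub {E : Finset (Z2 (n + 2))} {u v : Z2 (n + 2)}
    (hu0 : u ≠ 0) (hv0 : v ≠ 0) (huv0 : u + v ≠ 0) (hu : u ∉ E - E) (hv : v ∉ E - E)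
    (huv : u + v ∉ E - E) : ProjectsInjectively n E := by
  obtain ⟨L, hL⟩ := exists_linearMap_ker_eq_pair hu0
  refine .of_image (injOn_of_notMem_sub hu fun x => (hL x).1) (.of_notMem_sub (u := L v) ?_ ?_)
  · rw [ne_eq, hL]
    rintro (rfl | rfl)
    exacts [hv0 rfl, huv0 (ZModModule.add_self v)]
  · rw [mem_sub]
    rintro ⟨_, hLx, _, hLy, hxy⟩
    obtain ⟨x, hx, rfl⟩ := mem_image.1 hLx
    obtain ⟨y, hy, rfl⟩ := mem_image.1 hLy
    rw [← map_sub, ← sub_eq_zero, ← map_sub, hL] at hxy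
    have hmem : x - y ∈ E - E := sub_mem_sub hx hy
    obtain h | h := hxy
    · exact hv (sub_eq_zero.1 h ▸ hmem)
    · exact huv (sub_eq_iff_eq_add.1 h ▸ hmem)

end Projections

section Counting

theorem sum_card_filter_add_mem {G : Type*} [AddGroup G] [Fintype G] [DecidableEq G]
    (E : Finset G) : ∑ u, #{x ∈ E | x + u ∈ E} = #E * #E := by
  calc ∑ u, #{x ∈ E | x + u ∈ E} = ∑ x ∈ E, #{u | x + u ∈ E} := by
        simp only [card_filter]
        exact sum_comm
    _ = ∑ _x ∈ E, #E := by
        refine sum_congr rfl fun x _ => card_bij (fun u _ => x + u) (by simp) (by simp) ?_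
        exact fun y hy => ⟨-x + y, by simpa, add_neg_cancel_left x y⟩
    _ = #E * #E := by rw [sum_const, smul_eq_mul]

theorem exists_ne_zero_notMem_sub {E : Finset (Z2 n)} {m : ℕ}
    (hm : ∀ u ∈ E - E, u ≠ 0 → m ≤ #{x ∈ E | x + u ∈ E})
    (hE : #E * #E < #E + (2 ^ n - 1) * m) : ∃ u ≠ 0, u ∉ E - E := by
  by_contra! h
  refine hE.not_ge ?_
  calc #E + (2 ^ n - 1) * m = #{x ∈ E | x + 0 ∈ E} + #(univ.erase (0 : Z2 n)) • m := by
        rw [card_erase_of_mem (mem_univ _), card_univ, card_Z2]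
        simp
    _ ≤ #{x ∈ E | x + 0 ∈ E} + ∑ u ∈ univ.erase 0, #{x ∈ E | x + u ∈ E} := by
        gcongr
        refine card_nsmul_le_sum _ _ _ fun u hu => ?_
        exact hm u (h u (ne_of_mem_erase hu)) (ne_of_mem_erase hu)
    _ = #E * #E := by
        rw [add_sum_erase univ (fun u => #{x ∈ E | x + u ∈ E}) (mem_univ 0),
          sum_card_filter_add_mem]

theorem add_sub_self_eq_right (x y : Z2 n) : x + (x - y) = y := by
  rw [ZModModule.sub_eq_add, ← add_assoc, ZModModule.add_self, zero_add]

theorem two_le_card_filter_add_mem {E : Finset (Z2 n)} {u : Z2 n} (hu : u ∈ E - E) (hu0 : u ≠ 0) :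
    2 ≤ #{x ∈ E | x + u ∈ E} := by
  obtain ⟨x, hx, y, hy, rfl⟩ := mem_sub.1 hu
  refine (card_pair (sub_ne_zero.1 hu0)).symm.trans_le (card_le_card ?_)
  simp [insert_subset_iff, add_sub_self_eq_right, hx, hy]

theorem projectsInjectively_of_card {E : Finset (Z2 d)} (hkd : k ≤ d)
    (hE : #E * #E < #E + (2 ^ (k + 1) - 1) * 2) : ProjectsInjectively k E := by
  induction d, hkd using Nat.le_induction with
  | base => exact projectsInjectively_self E
  | succ n hkn ih =>
    obtain ⟨u, hu0, hu⟩ := exists_ne_zero_notMem_sub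
      (fun u => two_le_card_filter_add_mem (E := E)) (hE.trans_le (by gcongr; omega))
    obtain ⟨L, hL⟩ := ProjectsInjectively.of_notMem_sub hu0 hu
    exact .of_image hL (ih (by rwa [card_image_of_injOn hL]))

theorem sum_univ_Z2 (hn : 2 ≤ n) : ∑ x : Z2 n, x = 0 := by
  ext i
  have h := MvPolynomial.sum_eval_eq_zero (MvPolynomial.X i : MvPolynomial (Fin n) (ZMod 2)) (by
    rw [MvPolynomial.totalDegree_X, ZMod.card, Fintype.card_fin]
    omega)
  simpa [Finset.sum_apply] using h

/-- Project along `x - y`. If only `x` and `y` collided, the image would miss a single point `z`;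
as both `E` and the target space have sum zero, `z` would be the common image of `x` and `y`. -/
theorem exists_add_sub_mem_of_sum_eq_zero (hn : 2 ≤ n) {E : Finset (Z2 (n + 1))} (hE : #E = 2 ^ n)
    (hE0 : ∑ z ∈ E, z = 0) {x y : Z2 (n + 1)} (hx : x ∈ E) (hy : y ∈ E) (hxy : x ≠ y) :
    ∃ z ∈ E, z ≠ x ∧ z ≠ y ∧ z + (x - y) ∈ E := by
  obtain ⟨L, hL⟩ := exists_linearMap_ker_eq_pair (sub_ne_zero.2 hxy)
  by_contra! hcon
  have hinj : Set.InjOn L (E.erase x) := by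
    intro a ha b hb hab
    obtain ⟨hax, ha⟩ := mem_erase.1 ha
    obtain ⟨hbx, hb⟩ := mem_erase.1 hb
    obtain h | h := (hL (a - b)).1 (by rw [map_sub, hab, sub_self])
    · exact sub_eq_zero.1 h
    · have ha' : a = b + (x - y) := by rw [← h, add_sub_cancel]
      obtain rfl : b = y := by_contra fun hby => hcon b hb hbx hby (ha' ▸ ha)
      exact absurd (ha'.trans (add_sub_cancel b x)) hax
  set I := (E.erase x).image L with hI
  obtain ⟨z, hz⟩ : ∃ z, Iᶜ = {z} := by
    rw [← card_eq_one, card_compl, hI, card_image_of_injOn hinj, card_erase_of_mem hx, hE,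
      card_Z2]
    have := Nat.one_le_two_pow (n := n)
    omega
  have hsumI : ∑ w ∈ I, w = -L x := by
    rw [hI, sum_image hinj, ← map_sum, sum_erase_eq_sub hx, hE0, zero_sub, map_neg]
  have hzx : z = L x := by
    have h := sum_add_sum_compl I id
    simp only [id, hz, sum_singleton, hsumI, sum_univ_Z2 hn] at h
    exact (neg_add_eq_zero.1 h).symm
  have hxI : L x ∈ I := by
    have hLxy : L x = L y := sub_eq_zero.1 (by rw [← map_sub, hL]; exact .inr rfl)
    exact hLxy ▸ mem_image_of_mem L (mem_erase.2 ⟨hxy.symm, hy⟩)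
  have hzI : z ∈ Iᶜ := hz ▸ mem_singleton_self z
  exact mem_compl.1 hzI (hzx ▸ hxI)

theorem four_le_card_filter_add_mem (hn : 2 ≤ n) {E : Finset (Z2 (n + 1))} (hE : #E = 2 ^ n)
    (hE0 : ∑ z ∈ E, z = 0) {u : Z2 (n + 1)} (hu : u ∈ E - E) (hu0 : u ≠ 0) :
    4 ≤ #{x ∈ E | x + u ∈ E} := by
  obtain ⟨x, hx, y, hy, rfl⟩ := mem_sub.1 hu
  have hxy := sub_ne_zero.1 hu0
  obtain ⟨z, hz, hzx, hzy, hz'⟩ := exists_add_sub_mem_of_sum_eq_zero hn hE hE0 hx hy hxy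
  have hinv : ∀ w, w + (x - y) + (x - y) = w := fun w => by
    rw [add_assoc, ZModModule.add_self, add_zero]
  have hcard : #{x, y, z, z + (x - y)} = 4 := by
    have h1 : z + (x - y) ≠ x := fun h => hzy <| by
      rw [← hinv z, h, add_sub_self_eq_right]
    have h2 : z + (x - y) ≠ y := fun h => hzx <| by
      rw [← hinv z, h, add_sub_cancel]
    exact card_eq_four.2 ⟨x, y, z, _, hxy, hzx.symm, h1.symm, hzy.symm, h2.symm,
      left_ne_add.2 hu0, rfl⟩
  refine hcard.symm.trans_le (card_le_card ?_)
  simp [insert_subset_iff, add_sub_self_eq_right, hinv, hx, hy, hz, hz']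

theorem projectsInjectively_three_of_sum_eq_zero {E : Finset (Z2 d)} (hE : #E = 8)
    (hE0 : ∑ x ∈ E, x = 0) : ProjectsInjectively 3 E := by
  obtain rfl | hd : 3 = d ∨ 4 ≤ d := eq_or_lt_of_le (le_of_card_eq_two_pow hE)
  · exact projectsInjectively_self E
  obtain ⟨L, hL⟩ := projectsInjectively_of_card (E := E) hd (by rw [hE]; norm_num)
  refine .of_image hL ?_
  have hcard : #(E.image L) = 8 := by rw [card_image_of_injOn hL, hE]
  have hsum : ∑ x ∈ E.image L, x = 0 := by rw [sum_image hL, ← map_sum, hE0, map_zero]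
  obtain ⟨u, hu0, hu⟩ := exists_ne_zero_notMem_sub
    (fun u => four_le_card_filter_add_mem (by norm_num) hcard hsum) (by rw [hcard]; norm_num)
  exact .of_notMem_sub hu0 hu

theorem projectsInjectively_three_of_sum_notMem_sub {E : Finset (Z2 d)} (hE : #E = 8)
    (h : ∑ x ∈ E, x ∈ E - E → ∑ x ∈ E, x = 0) : ProjectsInjectively 3 E := by
  by_cases h0 : ∑ x ∈ E, x = 0
  · exact projectsInjectively_three_of_sum_eq_zero hE h0
  obtain _ | n := d
  · exact absurd (Subsingleton.elim _ _) h0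
  obtain ⟨L, hL⟩ := exists_linearMap_ker_eq_pair h0
  have hinj := injOn_of_notMem_sub (mt h h0) fun x => (hL x).1
  refine .of_image hinj (projectsInjectively_three_of_sum_eq_zero ?_ ?_)
  · rw [card_image_of_injOn hinj, hE]
  · rw [sum_image hinj, ← map_sum, hL]
    exact .inr rfl

theorem projectsInjectively_of_disjoint_sub {E : Finset (Z2 d)} {S : Set (Z2 d)} (hE : #E = 2 ^ k)
    (hk : k ≤ 3 ∨ d ≤ k + 2) (hS : ∀ u ∈ S, u ∈ E - E → u = 0)
    (hsum : 4 ∣ #E → ∑ x ∈ E, x ∈ S) (hline : k < d → ∃ u ∈ S, u ≠ 0)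
    (hplane : k + 1 < d → ∃ u ∈ S, ∃ v ∈ S, u + v ∈ S ∧ u ≠ 0 ∧ v ≠ 0 ∧ u + v ≠ 0) :
    ProjectsInjectively k E := by
  have hkd : k ≤ d := le_of_card_eq_two_pow hE
  obtain hk2 | rfl | hdk : k ≤ 2 ∨ k = 3 ∨ d ≤ k + 2 := by omega
  · refine projectsInjectively_of_card hkd ?_
    rw [hE]
    interval_cases k <;> norm_num
  · exact projectsInjectively_three_of_sum_notMem_sub hE (hS _ (hsum (by norm_num [hE])))
  obtain rfl | rfl | rfl : d = k ∨ d = k + 1 ∨ d = k + 2 := by omega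
  · exact projectsInjectively_self E
  · obtain ⟨u, hu, hu0⟩ := hline (by omega)
    exact .of_notMem_sub hu0 (mt (hS u hu) hu0)
  · obtain ⟨u, hu, v, hv, huv, hu0, hv0, huv0⟩ := hplane (by omega)
    exact .of_plane_notMem_sub hu0 hv0 huv0 (mt (hS u hu) hu0) (mt (hS v hv) hv0)
      (mt (hS _ huv) huv0)

end Counting

section Exponentials

theorem expo_zero_left (x : Z2 d) : expo 0 x = 1 := by
  rw [expo, zero_dotProduct, AddChar.map_zero_eq_one]

theorem expo_comm (b x : Z2 d) : expo b x = expo x b := by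
  rw [expo, expo, dotProduct_comm]

theorem expo_add_right (b x y : Z2 d) : expo b (x + y) = expo b x * expo b y := by
  rw [expo, dotProduct_add, AddChar.map_add_eq_mul, expo, expo]

theorem expo_sub_left (b c x : Z2 d) : expo (b - c) x = expo b x * conj (expo c x) := by
  rw [expo, sub_dotProduct, sub_eq_add_neg, AddChar.map_add_eq_mul, AddChar.map_neg_eq_conj,
    expo, expo]

theorem expo_eq_ite (b x : Z2 d) : expo b x = if b ⬝ᵥ x = 0 then 1 else -1 := by
  unfold expo
  obtain h | h := zmod_two_eq_zero_or_one (b ⬝ᵥ x) <;> rw [h]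
  · rw [AddChar.map_zero_eq_one, if_pos rfl]
  · rw [if_neg one_ne_zero, ← Complex.exp_pi_mul_I]
    convert ZMod.stdAddChar_coe (N := 2) 1 using 2
    · exact Int.cast_one.symm
    · rw [Int.cast_one, Nat.cast_ofNat]
      ring

theorem sum_expo (b : Z2 d) : ∑ x, expo b x = if b = 0 then 2 ^ d else 0 := by
  split_ifs with hb
  · subst hb
    simp [expo_zero_left]
  · obtain ⟨i, hi⟩ := Function.ne_iff.1 hb
    have hflip : expo b (Pi.single i 1) = -1 := by
      rw [expo_eq_ite, dotProduct_single_one]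
      exact if_neg hi
    have hshift := Equiv.sum_comp (Equiv.addRight (Pi.single i 1 : Z2 d)) (expo b)
    simp only [Equiv.coe_addRight, expo_add_right, hflip, ← sum_mul] at hshift
    linear_combination -hshift / 2

end Exponentials

/-- The Fourier transform of the indicator function of `E`. -/
noncomputable def charSum (E : Finset (Z2 d)) (b : Z2 d) : ℂ :=
  ∑ x ∈ E, expo b x

section Fourier

theorem charSum_zero (E : Finset (Z2 d)) : charSum E 0 = #E := by
  simp [charSum, expo_zero_left]

theorem charSum_sub (E : Finset (Z2 d)) (b c : Z2 d) :
    charSum E (b - c) = ∑ x ∈ E, expo b x * conj (expo c x) := by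
  simp only [charSum, expo_sub_left]

theorem sum_charSum_mul_conj_expo (E : Finset (Z2 d)) (x : Z2 d) :
    ∑ b, charSum E b * conj (expo b x) = if x ∈ E then 2 ^ d else 0 := by
  calc ∑ b, charSum E b * conj (expo b x) = ∑ y ∈ E, ∑ b, expo (y - x) b := by
        simp only [charSum, sum_mul, expo_sub_left, expo_comm _ x]
        rw [sum_comm]
        simp only [expo_comm]
    _ = ∑ y ∈ E, if y = x then 2 ^ d else 0 := by simp only [sum_expo, sub_eq_zero]
    _ = if x ∈ E then 2 ^ d else 0 := sum_ite_eq' ..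

theorem sum_charSum_mul_charSum_sub (E : Finset (Z2 d)) (b : Z2 d) :
    ∑ a, charSum E a * charSum E (b - a) = 2 ^ d * charSum E b := by
  calc ∑ a, charSum E a * charSum E (b - a)
      = ∑ x ∈ E, expo b x * ∑ a, charSum E a * conj (expo a x) := by
        simp only [charSum_sub, mul_sum]
        rw [sum_comm]
        simp only [mul_left_comm]
    _ = ∑ x ∈ E, expo b x * 2 ^ d := by
        refine sum_congr rfl fun x hx => ?_
        rw [sum_charSum_mul_conj_expo, if_pos hx]
    _ = 2 ^ d * charSum E b := by rw [← sum_mul, charSum, mul_comm]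

theorem charSum_eq_card_sub (E : Finset (Z2 d)) (b : Z2 d) :
    charSum E b = #E - 2 * #{x ∈ E | b ⬝ᵥ x ≠ 0} := by
  rw [card_filter, card_eq_sum_ones, charSum]
  push_cast
  rw [mul_sum, ← sum_sub_distrib]
  refine sum_congr rfl fun x _ => ?_
  rw [expo_eq_ite]
  by_cases h : b ⬝ᵥ x = 0 <;> norm_num [h]

theorem dotProduct_sum_eq_card_filter (E : Finset (Z2 d)) (b : Z2 d) :
    b ⬝ᵥ ∑ x ∈ E, x = #{x ∈ E | b ⬝ᵥ x ≠ 0} := by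
  rw [dotProduct_sum, card_filter, Nat.cast_sum]
  refine sum_congr rfl fun x _ => ?_
  obtain h | h := zmod_two_eq_zero_or_one (b ⬝ᵥ x) <;> simp [h]

theorem dotProduct_sum_eq_zero_of_charSum_eq_zero {E : Finset (Z2 d)} (hE : 4 ∣ #E) {b : Z2 d}
    (hb : charSum E b = 0) : b ⬝ᵥ ∑ x ∈ E, x = 0 := by
  rw [charSum_eq_card_sub, sub_eq_zero] at hb
  have hcard : #E = 2 * #{x ∈ E | b ⬝ᵥ x ≠ 0} := by exact_mod_cast hb
  rw [dotProduct_sum_eq_card_filter, ZMod.natCast_eq_zero_iff]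
  omega

theorem expo_sum_eq_one_of_charSum_eq_zero {E : Finset (Z2 d)} (hE : 4 ∣ #E) {b : Z2 d}
    (hb : charSum E b = 0) : expo b (∑ x ∈ E, x) = 1 := by
  rw [expo_eq_ite, if_pos (dotProduct_sum_eq_zero_of_charSum_eq_zero hE hb)]

theorem exists_charSum_ne_zero {B : Finset (Z2 d)} (hB : B.Nonempty) (hlt : #B < 2 ^ d) :
    ∃ u ≠ 0, charSum B u ≠ 0 := by
  by_contra! h
  have hconv := sum_charSum_mul_charSum_sub B 0
  rw [Fintype.sum_eq_single 0 fun a ha => by rw [h a ha, zero_mul], sub_zero, charSum_zero] at hconv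
  have hB0 : (#B : ℂ) ≠ 0 := Nat.cast_ne_zero.2 hB.card_ne_zero
  have hcard : (#B : ℂ) = 2 ^ d := mul_right_cancel₀ hB0 hconv
  exact hlt.ne (by exact_mod_cast hcard)

theorem exists_charSum_add_ne_zero {B : Finset (Z2 d)} (hB : B.Nonempty) (hlt : 2 * #B < 2 ^ d) :
    ∃ u v, (charSum B u ≠ 0 ∧ charSum B v ≠ 0 ∧ charSum B (u + v) ≠ 0) ∧
      u ≠ 0 ∧ v ≠ 0 ∧ u + v ≠ 0 := by
  obtain ⟨w, hw0, hw⟩ := exists_charSum_ne_zero hB (by omega)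
  obtain ⟨u, ⟨hu0, huw⟩, hu⟩ :
      ∃ u, (u ≠ 0 ∧ u ≠ w) ∧ charSum B u * charSum B (w - u) ≠ 0 := by
    by_contra! h
    have hconv := sum_charSum_mul_charSum_sub B w
    rw [Fintype.sum_eq_add 0 w hw0.symm h, sub_zero, sub_self, charSum_zero] at hconv
    have hcard : (2 * #B : ℂ) = 2 ^ d := mul_right_cancel₀ hw (by linear_combination hconv)
    exact hlt.ne (by exact_mod_cast hcard)
  refine ⟨u, w - u, ⟨left_ne_zero_of_mul hu, right_ne_zero_of_mul hu, ?_⟩, hu0,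
    sub_ne_zero.2 huw.symm, ?_⟩ <;> rwa [add_sub_cancel]

end Fourier

section Tiles

/-- Every element of the group is uniquely a sum of an element of `E` and an element of `T`: the
condition on `T` in `IsTile`. -/
def IsTilingComplement (E T : Finset (Z2 d)) : Prop :=
  Set.BijOn (fun p : Z2 d × Z2 d => p.1 + p.2) (E ×ˢ T : Finset (Z2 d × Z2 d)) Set.univ

theorem isTile_iff {E : Finset (Z2 d)} : IsTile E ↔ ∃ T, IsTilingComplement E T := by
  refine exists_congr fun T => ⟨fun h => ⟨Set.mapsTo_univ _ _, ?_, ?_⟩, fun h g => ?_⟩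
  · rintro p hp q hq hpq
    rw [mem_coe, mem_product] at hp hq
    exact (h _).unique ⟨hp.1, hp.2, rfl⟩ ⟨hq.1, hq.2, hpq.symm⟩
  · intro g _
    obtain ⟨p, ⟨hpE, hpT, hp⟩, -⟩ := h g
    exact ⟨p, mem_product.2 ⟨hpE, hpT⟩, hp⟩
  · obtain ⟨p, hp, hpg⟩ := h.surjOn (Set.mem_univ g)
    rw [mem_coe, mem_product] at hp
    exact ⟨p, ⟨hp.1, hp.2, hpg⟩, fun q ⟨hqE, hqT, hq⟩ =>
      h.injOn (mem_product.2 ⟨hqE, hqT⟩) (mem_product.2 hp) (hq.trans hpg.symm)⟩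

theorem IsTilingComplement.card_mul_card {E T : Finset (Z2 d)} (h : IsTilingComplement E T) :
    #E * #T = 2 ^ d := by
  rw [← card_product, ← card_Z2 d, ← card_univ]
  refine card_nbij _ (fun _ _ => mem_univ _) h.injOn ?_
  rw [coe_univ]
  exact h.surjOn

theorem IsTilingComplement.charSum_mul_charSum {E T : Finset (Z2 d)}
    (h : IsTilingComplement E T) (b : Z2 d) :
    charSum E b * charSum T b = if b = 0 then 2 ^ d else 0 := by
  rw [← sum_expo, charSum, charSum, sum_mul_sum, ← sum_product']
  refine sum_nbij _ (fun _ _ => mem_univ _) h.injOn ?_ fun p _ => (expo_add_right b p.1 p.2).symm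
  rw [coe_univ]
  exact h.surjOn

theorem IsTilingComplement.nonempty_right {E T : Finset (Z2 d)} (h : IsTilingComplement E T) :
    T.Nonempty := by
  obtain ⟨p, hp, -⟩ := h.surjOn (Set.mem_univ 0)
  exact ⟨p.2, (mem_product.1 hp).2⟩

theorem IsTilingComplement.eq_zero_of_mem_sub {E T : Finset (Z2 d)} (h : IsTilingComplement E T)
    {u : Z2 d} (huT : u ∈ T - T) (huE : u ∈ E - E) : u = 0 := by
  obtain ⟨s, hs, t, ht, rfl⟩ := mem_sub.1 huT
  obtain ⟨x, hx, y, hy, hxy⟩ := mem_sub.1 huE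
  have hpair : (x, t) = (y, s) := h.injOn (mem_product.2 ⟨hx, ht⟩) (mem_product.2 ⟨hy, hs⟩)
    (by linear_combination (exp := 1) hxy)
  rw [(Prod.mk.inj hpair).2, sub_self]

theorem IsTilingComplement.sum_mem_sub {E T : Finset (Z2 d)} (h : IsTilingComplement E T)
    (hE : 4 ∣ #E) : ∑ x ∈ E, x ∈ T - T := by
  set v := ∑ x ∈ E, x
  obtain ⟨t, ht⟩ := h.nonempty_right
  -- `charSum T` lives on the hyperplane orthogonal to `v`, so `T` is periodic with period `v`.
  have hexpo : ∀ b, charSum T b = 0 ∨ expo b v = 1 := by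
    intro b
    obtain rfl | hb := eq_or_ne b 0
    · exact .inr (expo_zero_left v)
    have hprod := h.charSum_mul_charSum b
    rw [if_neg hb, mul_eq_zero] at hprod
    exact hprod.symm.imp_right (expo_sum_eq_one_of_charSum_eq_zero hE)
  have hshift : ∑ b, charSum T b * conj (expo b (t + v)) = ∑ b, charSum T b * conj (expo b t) := by
    refine sum_congr rfl fun b _ => ?_
    obtain h0 | h1 := hexpo b
    · rw [h0, zero_mul, zero_mul]
    · rw [expo_add_right, h1, mul_one]
  have htv : t + v ∈ T := by
    by_contra hn
    rw [sum_charSum_mul_conj_expo, sum_charSum_mul_conj_expo, if_neg hn, if_pos ht] at hshift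
    exact pow_ne_zero d two_ne_zero hshift.symm
  exact mem_sub.2 ⟨t + v, htv, t, ht, add_sub_cancel_left t v⟩

theorem IsTile.projectsInjectively {E : Finset (Z2 d)} (h : IsTile E) (hE : #E = 2 ^ k)
    (hk : k ≤ 3 ∨ d ≤ k + 2) : ProjectsInjectively k E := by
  obtain ⟨T, h⟩ := isTile_iff.1 h
  have hT : ∀ m, k + m ≤ d → 2 ^ m ≤ #T := by
    intro m hm
    refine Nat.le_of_mul_le_mul_left ?_ (show 0 < 2 ^ k by positivity)
    rw [← pow_add, ← hE, h.card_mul_card]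
    exact Nat.pow_le_pow_right two_pos hm
  refine projectsInjectively_of_disjoint_sub (S := (T - T : Finset (Z2 d))) hE hk
    (fun u => h.eq_zero_of_mem_sub) h.sum_mem_sub (fun hkd => ?_) fun hkd => ?_
  · obtain ⟨s, hs, t, ht, hst⟩ := one_lt_card.1 (hT 1 hkd)
    exact ⟨s - t, sub_mem_sub hs ht, sub_ne_zero.2 hst⟩
  · obtain ⟨r, hr, s, hs, t, ht, hrs, hrt, hst⟩ := two_lt_card.1 (hT 2 hkd |>.trans' (by norm_num))
    refine ⟨r - s, sub_mem_sub hr hs, s - t, sub_mem_sub hs ht, ?_⟩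
    rw [sub_add_sub_cancel]
    exact ⟨sub_mem_sub hr ht, sub_ne_zero.2 hrs, sub_ne_zero.2 hst, sub_ne_zero.2 hrt⟩

end Tiles

section Spectra

theorem IsSpectrum.charSum_sub_eq_zero {E B : Finset (Z2 d)} (h : IsSpectrum E B) {b c : Z2 d}
    (hb : b ∈ B) (hc : c ∈ B) (hbc : b ≠ c) : charSum E (b - c) = 0 := by
  rw [charSum_sub, h.1 b hb c hc hbc]

/-- The matrix with entries `charSum B (x - y)` multiplies each `expo c`, `c ∈ B`, by `|E|`, and
these functions span `L²(E)`. -/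
theorem IsSpectrum.charSum_sub_eq_ite {E B : Finset (Z2 d)} (h : IsSpectrum E B) (x y : E) :
    charSum B (x - y : Z2 d) = if x = y then (#E : ℂ) else 0 := by
  let G : Matrix E E ℂ := Matrix.of fun x y => charSum B (x - y : Z2 d)
  have hG : Matrix.toLin' G = (#E : ℂ) • LinearMap.id := by
    refine LinearMap.ext_on h.2 ?_
    rintro _ ⟨c, hc, rfl⟩
    ext x
    calc ∑ y : E, charSum B (x - y : Z2 d) * expo c y
        = ∑ b ∈ B, expo b x * charSum E (c - b) := by
          simp only [charSum_sub, sum_mul, mul_sum, expo_comm _ (x : Z2 d)]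
          rw [sum_comm]
          refine sum_congr rfl fun b _ => ?_
          rw [← sum_coe_sort E]
          refine sum_congr rfl fun y _ => ?_
          rw [expo_comm (y : Z2 d)]
          ring
      _ = ∑ b ∈ B, if b = c then expo b x * #E else 0 := by
          refine sum_congr rfl fun b hb => ?_
          split_ifs with hbc
          · rw [hbc, sub_self, charSum_zero]
          · rw [h.charSum_sub_eq_zero hc hb (Ne.symm hbc), mul_zero]
      _ = #E * expo c x := by rw [sum_ite_eq', if_pos (mem_coe.1 hc), mul_comm]
  have hxy := congrFun (congrArg (fun f => f (Pi.single y 1)) hG) x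
  simpa [G, Pi.single_apply] using hxy

theorem IsSpectrum.card_eq {E B : Finset (Z2 d)} (h : IsSpectrum E B) (hE : E.Nonempty) :
    #B = #E := by
  obtain ⟨x, hx⟩ := hE
  have hB := h.charSum_sub_eq_ite ⟨x, hx⟩ ⟨x, hx⟩
  rw [sub_self, charSum_zero, if_pos rfl] at hB
  exact_mod_cast hB

theorem IsSpectrum.eq_zero_of_mem_sub {E B : Finset (Z2 d)} (h : IsSpectrum E B) {u : Z2 d}
    (huB : charSum B u ≠ 0) (huE : u ∈ E - E) : u = 0 := by
  obtain ⟨x, hx, y, hy, rfl⟩ := mem_sub.1 huE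
  by_contra hxy
  have hne : (⟨x, hx⟩ : E) ≠ ⟨y, hy⟩ := fun he => hxy (sub_eq_zero.2 (congrArg Subtype.val he))
  exact huB ((h.charSum_sub_eq_ite ⟨x, hx⟩ ⟨y, hy⟩).trans (if_neg hne))

theorem IsSpectrum.charSum_sum_ne_zero {E B : Finset (Z2 d)} (h : IsSpectrum E B)
    (hB : B.Nonempty) (hE : 4 ∣ #E) : charSum B (∑ x ∈ E, x) ≠ 0 := by
  set v := ∑ x ∈ E, x
  obtain ⟨c, hc⟩ := hB
  have hexpo : ∀ b ∈ B, expo (b - c) v = 1 := by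
    intro b hb
    obtain rfl | hbc := eq_or_ne b c
    · rw [sub_self, expo_zero_left]
    · exact expo_sum_eq_one_of_charSum_eq_zero hE (h.charSum_sub_eq_zero hb hc hbc)
  have hsum : charSum B v * conj (expo c v) = #B := by
    calc charSum B v * conj (expo c v) = ∑ b ∈ B, expo (b - c) v := by
          simp only [charSum, sum_mul, expo_comm v, expo_sub_left]
      _ = #B := by rw [sum_congr rfl hexpo, sum_const, nsmul_one]
  refine left_ne_zero_of_mul (hsum.trans_ne ?_)
  exact Nat.cast_ne_zero.2 (card_ne_zero_of_mem hc)

theorem IsSpectral.projectsInjectively {E : Finset (Z2 d)} (h : IsSpectral E) (hE : #E = 2 ^ k)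
    (hk : k ≤ 3 ∨ d ≤ k + 2) : ProjectsInjectively k E := by
  obtain ⟨B, h⟩ := h
  have hBE : #B = 2 ^ k := by rw [h.card_eq (card_pos.1 (by rw [hE]; positivity)), hE]
  have hB : B.Nonempty := card_pos.1 (by rw [hBE]; positivity)
  refine projectsInjectively_of_disjoint_sub (S := {u | charSum B u ≠ 0}) hE hk
    (fun u => h.eq_zero_of_mem_sub) (h.charSum_sum_ne_zero hB) (fun hkd => ?_) fun hkd => ?_
  · obtain ⟨u, hu0, hu⟩ := exists_charSum_ne_zero hB (hBE ▸ Nat.pow_lt_pow_right one_lt_two hkd)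
    exact ⟨u, hu, hu0⟩
  · have hlt : 2 * #B < 2 ^ d := by
      rw [hBE, ← pow_succ']
      exact Nat.pow_lt_pow_right one_lt_two hkd
    obtain ⟨u, v, ⟨hu, hv, huv⟩, hne⟩ := exists_charSum_add_ne_zero hB hlt
    exact ⟨u, hu, v, hv, huv, hne⟩

theorem span_expo_eq_top {E B : Finset (Z2 d)} {a : ℂ} (ha : a ≠ 0)
    (h : ∀ x y : E, charSum B (x - y : Z2 d) = if x = y then a else 0) :
    Submodule.span ℂ ((fun (b : Z2 d) (x : E) => expo b (x : Z2 d)) '' (B : Set (Z2 d))) = ⊤ := by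
  refine eq_top_iff.2 fun f _ => ?_
  have hf : f = ∑ b ∈ B, (a⁻¹ * ∑ y : E, f y * conj (expo b y)) •
      fun x : E => expo b (x : Z2 d) := by
    ext x
    calc f x = a⁻¹ * ∑ y : E, f y * charSum B (x - y : Z2 d) := by
          simp [h, mul_comm (f x), inv_mul_cancel_left₀ ha]
      _ = _ := by
          simp only [charSum_sub, Finset.sum_apply, Pi.smul_apply, smul_eq_mul, mul_sum, sum_mul]
          rw [sum_comm]
          refine sum_congr rfl fun b _ => sum_congr rfl fun y _ => ?_
          rw [expo_comm b, expo_comm b]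
          ring
  rw [hf]
  exact Submodule.sum_mem _ fun b hb => Submodule.smul_mem _ _ (Submodule.subset_span ⟨b, hb, rfl⟩)

end Spectra

section Transversals

theorem exists_expo_eq_expo_map (L : Z2 d →ₗ[ZMod 2] Z2 k) :
    ∃ M : Z2 k →ₗ[ZMod 2] Z2 d, ∀ c x, expo (M c) x = expo c (L x) := by
  refine ⟨Matrix.vecMulLinear (LinearMap.toMatrix' L), fun c x => ?_⟩
  rw [expo, expo, Matrix.vecMulLinear_apply, ← Matrix.dotProduct_mulVec,
    LinearMap.toMatrix'_mulVec]

theorem ProjectsInjectively.exists_bijOn {E : Finset (Z2 d)} (h : ProjectsInjectively k E)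
    (hE : #E = 2 ^ k) : ∃ L : Z2 d →ₗ[ZMod 2] Z2 k, Set.BijOn L E Set.univ := by
  obtain ⟨L, hL⟩ := h
  refine ⟨L, Set.mapsTo_univ _ _, hL, ?_⟩
  have himage : E.image L = univ := by
    rw [← card_eq_iff_eq_univ, card_image_of_injOn hL, hE, card_Z2]
  rw [Set.SurjOn, ← coe_image, himage, coe_univ]

theorem ProjectsInjectively.isTile {E : Finset (Z2 d)} (h : ProjectsInjectively k E)
    (hE : #E = 2 ^ k) : IsTile E := by
  obtain ⟨L, -, hinj, hsurj⟩ := h.exists_bijOn hE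
  refine ⟨univ.filter fun t => L t = 0, fun g => ?_⟩
  obtain ⟨x, hx, hxg⟩ := hsurj (Set.mem_univ (L g))
  refine ⟨(x, g - x), ⟨hx, by simp [hxg], add_sub_cancel x g⟩, ?_⟩
  rintro ⟨y, t⟩ ⟨hy, ht, rfl⟩
  have hyx : L y = L x := by rw [hxg, map_add, (mem_filter.1 ht).2, add_zero]
  obtain rfl : y = x := hinj hy hx hyx
  rw [add_sub_cancel_left]

theorem ProjectsInjectively.isSpectral {E : Finset (Z2 d)} (h : ProjectsInjectively k E)
    (hE : #E = 2 ^ k) : IsSpectral E := by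
  obtain ⟨L, hL⟩ := h.exists_bijOn hE
  obtain ⟨M, hM⟩ := exists_expo_eq_expo_map L
  have horth : ∀ c, charSum E (M c) = if c = 0 then 2 ^ k else 0 := by
    intro c
    rw [← sum_expo, charSum]
    refine sum_nbij L (fun _ _ => mem_univ _) hL.injOn ?_ fun x _ => hM c x
    rw [coe_univ]
    exact hL.surjOn
  have hMinj : Function.Injective M := by
    refine (injective_iff_map_eq_zero M).2 fun c hc => by_contra fun hc0 => ?_
    have h0 := horth c
    rw [hc, charSum_zero, if_neg hc0, hE] at h0
    exact pow_ne_zero k two_ne_zero (by exact_mod_cast h0)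
  refine ⟨univ.image M, ?_, span_expo_eq_top (pow_ne_zero k two_ne_zero) fun x y => ?_⟩
  · intro b hb b' hb' hne
    obtain ⟨c, -, rfl⟩ := mem_image.1 hb
    obtain ⟨c', -, rfl⟩ := mem_image.1 hb'
    have hcc : c - c' ≠ 0 := sub_ne_zero.2 fun he => hne (congrArg M he)
    rw [← charSum_sub, ← map_sub, horth, if_neg hcc]
  · have hxy : L x - L y = 0 ↔ x = y := by
      rw [sub_eq_zero, hL.injOn.eq_iff x.2 y.2, Subtype.ext_iff]
    calc charSum (univ.image M) (x - y : Z2 d) = ∑ c, expo (L x - L y) c := by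
          rw [charSum, sum_image hMinj.injOn]
          refine sum_congr rfl fun c _ => ?_
          rw [expo_comm, hM, map_sub, expo_comm]
      _ = if x = y then 2 ^ k else 0 := by simp only [sum_expo, hxy]

end Transversals

theorem proposition3p1_general {E : Finset (Z2 d)} (hE : #E = 2 ^ k) (hk : k ≤ 3 ∨ d ≤ k + 2) :
    IsSpectral E ↔ IsTile E :=
  ⟨fun h => (h.projectsInjectively hE hk).isTile hE,
    fun h => (h.projectsInjectively hE hk).isSpectral hE⟩

theorem proposition3p1 (d : ℕ) (hd : d = 5 ∨ d = 6) (E : Finset (Z2 d))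
    (hE : ∃ k : ℕ, E.card = 2 ^ k) : IsSpectral E ↔ IsTile E := by
  obtain ⟨k, hk⟩ := hE
  exact proposition3p1_general hk (by omega)
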